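/- Let $\mathtt{TopAlg}$ be the category of topological algebras: the objects are Hausdorff locally convex spaces $A$ over $\mathbb C$ with an associative, separately continuous multiplication and a unit; the morphisms are the continuous homomorphisms of algebras that preserve the unit. A Banach algebra is a topological algebra whose topology is given by a complete submultiplicative norm. For a topological algebra $A$ and a submultiplicative neighbourhood of zero $U$ (a closed absolutely convex neighbourhood of zero with $U\cdot U\subseteq U$) let $\operatorname{Ker}U=\bigcap_{\varepsilon>0}\varepsilon U$, let $A/U$ be the Banach algebra obtained by completing $A/\operatorname{Ker}U$ in the norm with unit ball $U+\operatorname{Ker}U$, and let $\rho_U:A\to A/U$ be the natural map. The maps $\rho_U$ form a projective cone over the system of all morphisms $\iota:A/V\to A/U$ with $\iota\circ\rho_V=\rho_U$. The Arens–Michael envelope $\heartsuit_A:A\to A^\heartsuit$ is the induced morphism into the projective limit $A^\heartsuit$ of this system in $\mathtt{TopAlg}$. Let $\Omega$ be a class of morphisms of $\mathtt{TopAlg}$. An extension of $A$ in $\Omega$ with respect to the class of Banach algebras is a morphism $\sigma:A\to A'$ in $\Omega$ such that for every Banach algebra $B$ and every morphism $\varphi:A\to B$ there is a unique morphism $\varphi':A'\to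 B$ with $\varphi'\circ\sigma=\varphi$. An envelope of $A$ in $\Omega$ with respect to the class of Banach algebras is an extension $\rho:A\to E$ such that for every extension $\sigma:A\to A'$ there is a unique morphism $\upsilon:A'\to E$ with $\upsilon\circ\sigma=\rho$; it is unique up to isomorphism, and it is written $\operatorname{env}^{\Omega}_{\mathtt{BanAlg}}A$. Let $\mathrm{Epi}$ be the class of all epimorphisms, $\mathrm{DEpi}$ the class of all dense epimorphisms (morphisms with dense image), and $\mathrm{SEpi}$ the class of all strong epimorphisms (epimorphisms with the left lifting property with respect to all monomorphisms) of $\mathtt{TopAlg}$. A nodal decomposition of a morphism $\varphi$ is a factorization $\varphi=\iota\circ\rho\circ\gamma$ with $\gamma$ a strong epimorphism, $\rho$ a bimorphism and $\iota$ a strong monomorphism; it is unique up to isomorphism, and $\gamma=\operatorname{coim}_\infty\varphi$ is the nodal coimage of $\varphi$. **Theorem.** Every topological algebra $A$ has an envelope with respect to the class of Banach algebras in each of the classes $\mathrm{Epi}$, $\mathrm{DEpi}$ and $\mathrm{SEpi}$. In the first two cases the envelopes coincide with each other and with the Arens–Michael envelope, $$\operatorname{env}^{\mathrm{Epi}}_{\mathtt{BanAlg}}A=\operatorname{env}^{\mathrm{DEpi}}_{\mathtt{BanAlg}}A=\heartsuit_A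 .$$ In the third case $\heartsuit_A$ has a nodal decomposition in $\mathtt{TopAlg}$, and the envelope is its nodal coimage, $$\operatorname{env}^{\mathrm{SEpi}}_{\mathtt{BanAlg}}A=\operatorname{coim}_\infty\heartsuit_A .$$ For each of the three classes $\Omega$ the envelope is a covariant functor from $\mathtt{TopAlg}$ into $\mathtt{TopAlg}$: for every morphism $\alpha:A\to B$ and all envelopes $e:A\to E$, $e':B\to E'$ in $\Omega$ there is a unique morphism $\alpha':E\to E'$ with $\alpha'\circ e=e'\circ\alpha$, and for every choice $e_A:A\to E_A$ of envelopes of all topological algebras there is a functor with $A\mapsto E_A$ on objects for which the $e_A$ form a natural transformation from the identity functor. -/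

import Mathlib

open CategoryTheory CategoryTheory.Limits

universe u v w

noncomputable section

/-! ### Extensions, envelopes and nodal decompositions in a category -/

section Envelopes

variable {C : Type u} [Category.{v} C]

/-- `σ : X ⟶ X'` is an extension of `X` in the class of morphisms `Ω` with respect to the class of
test morphisms `Φ`: it belongs to `Ω`, and every test morphism `X ⟶ B` extends uniquely
along `σ`. -/
def IsExtension (Ω Φ : MorphismProperty C) {X X' : C} (σ : X ⟶ X') : Prop :=
  Ω σ ∧ ∀ ⦃B : C⦄ (φ : X ⟶ B), Φ φ → ∃! φ' : X' ⟶ B, σ ≫ φ' = φ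

/-- `ρ : X ⟶ E` is an envelope of `X` in the class `Ω` with respect to the class `Φ`: it is an
extension, and every extension `σ : X ⟶ X'` maps uniquely to it under `X`. -/
def IsEnvelope (Ω Φ : MorphismProperty C) {X E : C} (ρ : X ⟶ E) : Prop :=
  IsExtension Ω Φ ρ ∧
    ∀ ⦃X' : C⦄ (σ : X ⟶ X'), IsExtension Ω Φ σ → ∃! υ : X' ⟶ E, σ ≫ υ = ρ

/-- Every object has an envelope in `Ω` with respect to `Φ`. -/
def HasEnvelopes (Ω Φ : MorphismProperty C) : Prop :=
  ∀ X : C, ∃ (E : C) (ρ : X ⟶ E), IsEnvelope Ω Φ ρ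

/-- The envelope in `Ω` with respect to `Φ` is a covariant functor:
every `α : X ⟶ Y` induces a unique morphism between any envelopes of `X` and `Y` that makes the
square commute, and for every choice `e X : X ⟶ E X` of envelopes there is an endofunctor with
object map `E` (and hence with these induced morphisms as its action on arrows) for which the
`e X` form a natural transformation from the identity. -/
def EnvelopeIsFunctor (Ω Φ : MorphismProperty C) : Prop :=
  (∀ ⦃X Y E E' : C⦄ (e : X ⟶ E) (e' : Y ⟶ E'), IsEnvelope Ω Φ e → IsEnvelope Ω Φ e' →
    ∀ α : X ⟶ Y, ∃! α' : E ⟶ E', e ≫ α' = α ≫ e') ∧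
  ∀ (E : C → C) (e : ∀ X, X ⟶ E X), (∀ X, IsEnvelope Ω Φ (e X)) →
    ∃ (F : C ⥤ C) (η : 𝟭 C ⟶ F) (h : ∀ X, F.obj X = E X),
      ∀ X, η.app X ≫ eqToHom (h X) = e X

/-- The class of all strong epimorphisms. -/
def strongEpiClass (C : Type u) [Category.{v} C] : MorphismProperty C := fun _ _ f => StrongEpi f

/-- A nodal decomposition of `f`: a strong epimorphism (the nodal coimage), followed by a
bimorphism (the nodal reduced part), followed by a strong monomorphism (the nodal image). -/
structure NodalDecomposition {X Y : C} (f : X ⟶ Y) where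
  /-- The range of the nodal coimage. -/
  Coim : C
  /-- The domain of the nodal image. -/
  Im : C
  /-- The nodal coimage. -/
  coim : X ⟶ Coim
  /-- The nodal reduced part. -/
  red : Coim ⟶ Im
  /-- The nodal image. -/
  im : Im ⟶ Y
  strongEpi_coim : StrongEpi coim
  mono_red : Mono red
  epi_red : Epi red
  strongMono_im : StrongMono im
  fac : coim ≫ red ≫ im = f

end Envelopes

/-! ### The category of topological algebras -/

/-- A topological algebra: a Hausdorff locally convex space over `ℂ` with an associative unital
separately continuous multiplication. -/
structure TopAlg where
  /-- The underlying type. -/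
  carrier : Type u
  [ring : Ring carrier]
  [algebra : Algebra ℂ carrier]
  [topology : TopologicalSpace carrier]
  [t2 : T2Space carrier]
  [isTopologicalAddGroup : IsTopologicalAddGroup carrier]
  [continuousSMul : ContinuousSMul ℂ carrier]
  [locallyConvex : LocallyConvexSpace ℝ carrier]
  [separatelyContinuousMul : SeparatelyContinuousMul carrier]

namespace TopAlg

attribute [instance] ring algebra topology t2 isTopologicalAddGroup continuousSMul locallyConvex
  separatelyContinuousMul

instance : CoeSort TopAlg.{u} (Type u) := ⟨carrier⟩

/-- Morphisms are the continuous homomorphisms of unital `ℂ`-algebras. -/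
@[ext]
structure Hom (A B : TopAlg.{u}) where
  /-- The underlying continuous algebra homomorphism. -/
  hom : A →A[ℂ] B

instance : Category TopAlg.{u} where
  Hom A B := Hom A B
  id A := ⟨ContinuousAlgHom.id ℂ A⟩
  comp f g := ⟨g.hom.comp f.hom⟩

instance : ConcreteCategory TopAlg.{u} (fun A B => A →A[ℂ] B) where
  hom := Hom.hom
  ofHom := Hom.mk

/-- A morphism given by a continuous algebra homomorphism. -/
abbrev ofHom {A B : TopAlg.{u}} (f : A →A[ℂ] B) : A ⟶ B := ConcreteCategory.ofHom f

/-- A Banach algebra (with a submultiplicative norm) as a topological algebra. -/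
def ofBanach (R : Type u) [NormedRing R] [NormedAlgebra ℂ R] [CompleteSpace R] :
    TopAlg.{u} :=
  { carrier := R }

/-- A topological algebra is a Banach algebra if it is isomorphic, as a topological algebra, to a
complete normed algebra; equivalently, its topology is given by a complete submultiplicative
norm. -/
def IsBanach (B : TopAlg.{u}) : Prop :=
  ∃ (R : Type u) (_ : NormedRing R) (_ : NormedAlgebra ℂ R) (_ : CompleteSpace R),
    Nonempty (B ≅ ofBanach R)

/-- The test morphisms: all morphisms with values in Banach algebras. -/
def toBanach : MorphismProperty TopAlg.{u} := fun _ B _ => B.IsBanach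

/-- The class of dense epimorphisms: morphisms whose image is dense. -/
def denseEpiClass : MorphismProperty TopAlg.{u} :=
  fun _ _ f => DenseRange (ConcreteCategory.hom f)

/-! Projective limits in the category of topological algebras: the closed subalgebra of compatible
families in the product. -/

section Limits

variable {J : Type u} [SmallCategory J] (F : J ⥤ TopAlg.{u})

/-- The subalgebra of compatible families. -/
def limitSubalgebra : Subalgebra ℂ (∀ j, F.obj j) where
  carrier := {x | ∀ ⦃i j : J⦄ (f : i ⟶ j), ConcreteCategory.hom (F.map f) (x i) = x j}
  mul_mem' hx hy i j f := by simp [hx f, hy f]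
  add_mem' hx hy i j f := by simp [hx f, hy f]
  algebraMap_mem' r i j f := by
    simp only [Pi.algebraMap_apply]
    exact AlgHomClass.commutes _ r

instance : LocallyConvexSpace ℝ (∀ j, F.obj j) :=
  LocallyConvexSpace.iInf fun j => LocallyConvexSpace.induced
    ((LinearMap.proj (R := ℝ) (φ := fun j => (F.obj j : Type u)) j))

/-- The vertex of the limit cone. -/
def limitPt : TopAlg.{u} :=
  { carrier := limitSubalgebra F
    isTopologicalAddGroup :=
      inferInstanceAs (IsTopologicalAddGroup (Subalgebra.toSubmodule (limitSubalgebra F)))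
    continuousSMul :=
      inferInstanceAs (ContinuousSMul ℂ (Subalgebra.toSubmodule (limitSubalgebra F)))
    locallyConvex := Topology.IsInducing.locallyConvexSpace (𝕜 := ℝ)
      (f := ((limitSubalgebra F).val.toLinearMap.restrictScalars ℝ)) Topology.IsInducing.subtypeVal
    separatelyContinuousMul :=
      { continuous_const_mul := by
          intro a
          refine Continuous.subtype_mk (continuous_pi fun j => ?_) _
          exact (continuous_const_mul (a.1 j)).comp
            ((continuous_apply j).comp continuous_subtype_val)
        continuous_mul_const := by
          intro a
          refine Continuous.subtype_mk (continuous_pi fun j => ?_) _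
          exact (continuous_mul_const (a.1 j)).comp
            ((continuous_apply j).comp continuous_subtype_val) } }

/-- The limit cone. -/
def limitCone : Cone F where
  pt := limitPt F
  π :=
    { app := fun j => ofHom
        ⟨(Pi.evalAlgHom ℂ (fun j => (F.obj j : Type u)) j).comp (limitSubalgebra F).val,
          (continuous_apply j).comp continuous_subtype_val⟩
      naturality := fun i j f => by
        apply ConcreteCategory.hom_ext
        intro x
        exact (x.2 f).symm }

/-- The limit cone is a limit. -/
def limitConeIsLimit : IsLimit (limitCone F) where
  lift s := ofHom
    ⟨(AlgHom.pi fun j => (ConcreteCategory.hom (s.π.app j)).toAlgHom).codRestrict (limitSubalgebra F) (fun x i j f => by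
        have h := s.w f
        exact congrArg (fun g : s.pt ⟶ F.obj j => ConcreteCategory.hom g x) h),
      Continuous.subtype_mk (continuous_pi fun j =>
        (ConcreteCategory.hom (s.π.app j) : s.pt →A[ℂ] F.obj j).cont) _⟩
  fac s j := rfl
  uniq s m h := by
    apply ConcreteCategory.hom_ext
    intro x
    refine Subtype.ext (funext fun j => ?_)
    exact congrArg (fun g : s.pt ⟶ F.obj j => ConcreteCategory.hom g x) (h j)

instance : HasLimits TopAlg.{u} where
  has_limits_of_shape _ _ :=
    { has_limit := fun F => ⟨⟨⟨limitCone F, limitConeIsLimit F⟩⟩⟩ }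

end Limits

/-! ### Banach quotient algebras and the Arens–Michael envelope -/

/-- A submultiplicative neighbourhood of zero: an absolutely convex closed neighbourhood `U` of
zero with `U · U ⊆ U`. -/
structure SubmultNhd (A : TopAlg.{u}) where
  /-- The underlying set. -/
  carrier : Set A
  mem_nhds : carrier ∈ nhds (0 : A)
  isClosed : IsClosed carrier
  balanced : Balanced ℂ carrier
  convex : Convex ℝ carrier
  mul_mem : ∀ ⦃x y : A⦄, x ∈ carrier → y ∈ carrier → x * y ∈ carrier

namespace SubmultNhd

variable {A : TopAlg.{u}} (U : SubmultNhd A)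

instance : ContinuousSMul ℝ A :=
  IsScalarTower.continuousSMul ℂ

theorem absorbent : Absorbent ℝ U.carrier := absorbent_nhds_zero U.mem_nhds

/-- The Minkowski functional of `U`. -/
def seminorm : Seminorm ℂ A := gaugeSeminorm U.balanced U.convex U.absorbent

theorem seminorm_mul_le (x y : A) : U.seminorm (x * y) ≤ U.seminorm x * U.seminorm y := by
  change gauge U.carrier (x * y) ≤ gauge U.carrier x * gauge U.carrier y
  have key : ∀ a b : ℝ, gauge U.carrier x < a → gauge U.carrier y < b →
      gauge U.carrier (x * y) ≤ a * b := by
    intro a b ha hb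
    obtain ⟨a', ha'0, ha', x', hx', rfl⟩ := exists_lt_of_gauge_lt U.absorbent ha
    obtain ⟨b', hb'0, hb', y', hy', rfl⟩ := exists_lt_of_gauge_lt U.absorbent hb
    refine le_trans (gauge_le_of_mem (by positivity) ?_)
      (mul_le_mul ha'.le hb'.le hb'0.le (ha'0.trans ha').le)
    refine ⟨x' * y', U.mul_mem hx' hy', ?_⟩
    simp only [smul_mul_assoc, mul_smul_comm, smul_smul, mul_comm]
  refine le_of_forall_pos_le_add fun ε hε => ?_
  have hc : Filter.Tendsto (fun δ : ℝ => (gauge U.carrier x + δ) * (gauge U.carrier y + δ))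
      (nhdsWithin 0 (Set.Ioi 0)) (nhds (gauge U.carrier x * gauge U.carrier y)) := by
    have : Continuous fun δ : ℝ => (gauge U.carrier x + δ) * (gauge U.carrier y + δ) := by
      fun_prop
    simpa using (this.tendsto 0).mono_left nhdsWithin_le_nhds
  have := ge_of_tendsto hc (Filter.eventually_of_mem self_mem_nhdsWithin fun δ (hδ : 0 < δ) =>
    key _ _ (lt_add_of_pos_right _ hδ) (lt_add_of_pos_right _ hδ))
  linarith

/-- The algebra `A` with the seminorm of `U` in place of its topology. -/
def Seminormed (_U : SubmultNhd A) : Type u := A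

instance : Ring U.Seminormed := inferInstanceAs (Ring A)

instance : SeminormedRing U.Seminormed :=
  RingSeminorm.toSeminormedRing
    { toFun := fun x => U.seminorm x
      map_zero' := map_zero U.seminorm
      add_le' := map_add_le_add U.seminorm
      neg' := map_neg_eq_map U.seminorm
      mul_le' := U.seminorm_mul_le }

instance : NormedAlgebra ℂ U.Seminormed :=
  { (inferInstanceAs (Algebra ℂ A) : Algebra ℂ U.Seminormed) with
    norm_smul_le := fun r x => (map_smul_eq_mul U.seminorm r x).le }

/-- The Hausdorff completion of `A` with respect to the seminorm of `U`, that is, the completion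
of the normed algebra `A / Ker U`, where `Ker U = ⋂_{ε > 0} ε U` is the zero set of the seminorm
and the norm is the one with unit ball `U + Ker U`. -/
def Completed : Type u := UniformSpace.Completion U.Seminormed

instance : NormedRing U.Completed :=
  inferInstanceAs (NormedRing (UniformSpace.Completion U.Seminormed))

instance : CompleteSpace U.Completed :=
  inferInstanceAs (CompleteSpace (UniformSpace.Completion U.Seminormed))

instance : NormedAlgebra ℂ U.Completed :=
  { (inferInstanceAs (Algebra ℂ (UniformSpace.Completion U.Seminormed)) :
      Algebra ℂ U.Completed) with
    norm_smul_le := fun r x =>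
      norm_smul_le r (show UniformSpace.Completion U.Seminormed from x) }

/-- The Banach quotient algebra `A / U`. -/
def quotient : TopAlg.{u} := ofBanach U.Completed

theorem continuous_toSeminormed : Continuous (fun x : A => (show U.Seminormed from x)) := by
  let f : A →+ U.Seminormed := AddMonoidHom.id A
  refine continuous_of_continuousAt_zero f ?_
  rw [ContinuousAt, map_zero, tendsto_zero_iff_norm_tendsto_zero]
  have h : Continuous U.seminorm := continuous_gauge U.convex U.mem_nhds
  simpa using! h.tendsto 0

/-- The Banach quotient map `ρ_U : A ⟶ A / U`. -/
def quotientMap : A ⟶ U.quotient :=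
  ofHom
    { toFun := fun x => ((show U.Seminormed from x : UniformSpace.Completion U.Seminormed))
      map_one' := UniformSpace.Completion.coe_one _
      map_mul' := fun x y => UniformSpace.Completion.coe_mul (α := U.Seminormed) x y
      map_zero' := UniformSpace.Completion.coe_zero
      map_add' := fun x y => UniformSpace.Completion.coe_add (α := U.Seminormed) x y
      commutes' := fun _ => rfl
      cont := (UniformSpace.Completion.continuous_coe U.Seminormed).comp
        U.continuous_toSeminormed }

end SubmultNhd

variable (A : TopAlg.{u})

/-- The system of binding morphisms: the Banach quotient maps `ρ_U`, as a full subcategory of the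
category of morphisms going from `A`. An arrow from `V` to `U` is a morphism `A / V ⟶ A / U` that
carries `ρ_V` to `ρ_U`. -/
abbrev QuotientIndex : Type u :=
  InducedCategory (Under A) fun U : SubmultNhd A => Under.mk U.quotientMap

/-- The diagram of the Banach quotient algebras `A / U` and the binding morphisms. -/
def quotientDiagram : QuotientIndex A ⥤ TopAlg.{u} :=
  inducedFunctor _ ⋙ Under.forget A

/-- The projective cone of all Banach quotient maps `ρ_U : A ⟶ A / U`. -/
def quotientCone : Cone (quotientDiagram A) where
  pt := A
  π :=
    { app := fun U => SubmultNhd.quotientMap U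
      naturality := fun _ _ f => (Category.id_comp _).trans (Under.w f.hom).symm }

/-- The range `A^♥` of the Arens–Michael envelope: the projective limit of the Banach quotient
algebras in the category of topological algebras. -/
def arensMichael : TopAlg.{u} := limit (quotientDiagram A)

/-- The Arens–Michael envelope `♥_A : A ⟶ A^♥`: the morphism into the projective limit induced by
the Banach quotient maps. -/
def heart : A ⟶ arensMichael A := limit.lift (quotientDiagram A) (quotientCone A)

end TopAlg

end

/-! Everything rests on two facts about `heart`: its image is dense, and every morphism from `A` to
a Banach algebra factors through it. The second holds because the preimage `U` of the unit ball is a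
submultiplicative neighbourhood whose gauge dominates the morphism, which therefore factors through
`ρ_U` (`IsBanach.exists_fac_quotientMap`). The first holds because a basic open set of the limit
involves finitely many coordinates, and one sufficiently small `V` controls them all
(`denseRange_heart`).

Conversely, let `e : X ⟶ E` be an extension and an epimorphism. For `α : X ⟶ Y` the morphisms `α ≫
ρ_U` extend along `e`; the extensions form a cone because `e` can be cancelled, so they give `E ⟶
arensMichael Y` (`exists_extend_heart`). Thus `heart` is an envelope in any class of epimorphisms
that contains it, in particular in `Epi` and `DEpi`, and functoriality comes from the same extension
property.

For `SEpi`, factor `heart` as a nodal coimage followed by a monomorphism. A strong epimorphism `e`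
lifts against this monomorphism, so the morphism just constructed descends to the coimage
(`exists_extend_coim`). Nodal decompositions exist by dividing by the kernel and then taking the
smallest absolutely closed subalgebra that contains the image. -/

/-! ### Abstract criteria for envelopes -/

section Envelopes

variable {C : Type u} [Category.{v} C] {Ω Φ : MorphismProperty C}

/-- If every object `Y` has an envelope `r Y` such that morphisms into `Y` extend along all
extensions to morphisms into the range of `r Y`, then envelopes are functorial. -/
theorem envelopeIsFunctor_of_exists_extend (hΩ : Ω ≤ MorphismProperty.epimorphisms C)
    (h : ∀ Y : C, ∃ (R : C) (r : Y ⟶ R), IsExtension Ω Φ r ∧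
      ∀ ⦃X E : C⦄ (e : X ⟶ E), IsExtension Ω Φ e → ∀ α : X ⟶ Y, ∃ γ : E ⟶ R, e ≫ γ = α ≫ r) :
    EnvelopeIsFunctor Ω Φ := by
  have key : ∀ ⦃X Y E E' : C⦄ (e : X ⟶ E) (e' : Y ⟶ E'), IsEnvelope Ω Φ e → IsEnvelope Ω Φ e' →
      ∀ α : X ⟶ Y, ∃! α' : E ⟶ E', e ≫ α' = α ≫ e' := by
    intro X Y E E' e e' he he' α
    have : Epi e := hΩ _ he.1.1
    obtain ⟨R, r, hr, hext⟩ := h Y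
    -- `γ` lands in the extension `r` of `Y`, and `t` compares `r` with the given envelope `e'`; the
    -- required morphism is their composite.
    obtain ⟨γ, hγ⟩ := hext e he.1 α
    obtain ⟨t, ht, -⟩ := he'.2 r hr
    refine ⟨γ ≫ t, ?_, fun β hβ => ?_⟩
    · simp only
      rw [← Category.assoc, hγ, Category.assoc, ht]
    · rw [← cancel_epi e, hβ, ← Category.assoc, hγ, Category.assoc, ht]
  refine ⟨key, fun E e he => ?_⟩
  -- Uniqueness of the induced morphisms forces the identity and composition laws.
  choose m hm hu using fun X Y (α : X ⟶ Y) => key (e X) (e Y) (he X) (he Y) α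
  refine ⟨{ obj := E, map := fun {X Y} α => m X Y α, map_id := fun X => ?_,
            map_comp := fun {X Y Z} f g => ?_ }, ⟨e, fun X Y f => (hm X Y f).symm⟩,
    fun _ => rfl, fun X => by simp⟩
  · exact (hu _ _ _ _ (by simp)).symm
  · refine (hu _ _ _ _ ?_).symm
    simp only
    rw [← Category.assoc, hm, Category.assoc, hm, Category.assoc]

/-- An extension to which all extensions map under `X` is an envelope. -/
theorem IsExtension.isEnvelope (hΩ : Ω ≤ MorphismProperty.epimorphisms C) {X R : C} {r : X ⟶ R}
    (hr : IsExtension Ω Φ r)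
    (h : ∀ ⦃E : C⦄ (e : X ⟶ E), IsExtension Ω Φ e → ∃ γ : E ⟶ R, e ≫ γ = r) :
    IsEnvelope Ω Φ r := by
  refine ⟨hr, fun E e he => ?_⟩
  have : Epi e := hΩ _ he.1
  obtain ⟨γ, hγ⟩ := h e he
  exact ⟨γ, hγ, fun δ hδ => by rw [← cancel_epi e, hδ, hγ]⟩

end Envelopes

namespace TopAlg

theorem hom_apply_congr {A B : TopAlg.{u}} {f g : A ⟶ B} (h : f = g) (x : A) :
    ConcreteCategory.hom f x = ConcreteCategory.hom g x := by rw [h]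

theorem continuous_hom {A B : TopAlg.{u}} (f : A ⟶ B) : Continuous (ConcreteCategory.hom f) :=
  (ConcreteCategory.hom f : A →A[ℂ] B).cont

/-! ### Subalgebras and quotients of topological algebras -/

/-- A subalgebra of a topological algebra, with the subspace topology. -/
def ofSubalgebra {R : Type u} [Ring R] [Algebra ℂ R] [TopologicalSpace R] [T2Space R]
    [IsTopologicalAddGroup R] [ContinuousSMul ℂ R] [LocallyConvexSpace ℝ R]
    [SeparatelyContinuousMul R] (S : Subalgebra ℂ R) : TopAlg.{u} :=
  { carrier := S
    isTopologicalAddGroup := inferInstanceAs (IsTopologicalAddGroup (Subalgebra.toSubmodule S))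
    continuousSMul := inferInstanceAs (ContinuousSMul ℂ (Subalgebra.toSubmodule S))
    locallyConvex := Topology.IsInducing.locallyConvexSpace (𝕜 := ℝ)
      (f := (S.val.toLinearMap.restrictScalars ℝ)) Topology.IsInducing.subtypeVal
    separatelyContinuousMul :=
      Topology.IsInducing.separatelyContinuousMul S.val Topology.IsInducing.subtypeVal }

/-- The kernel pair of `f` is a subalgebra of `A × A`, hence a topological algebra; its two
projections agree after `f`, so they are equal. -/
theorem ofHom_injective_of_mono {A B : TopAlg.{u}} (f : A ⟶ B) [Mono f] :
    Function.Injective (ConcreteCategory.hom f) := by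
  let S : Subalgebra ℂ (A × A) := AlgHom.equalizer
    (((ConcreteCategory.hom f) : A →A[ℂ] B).toAlgHom.comp (AlgHom.fst ℂ A A))
    (((ConcreteCategory.hom f) : A →A[ℂ] B).toAlgHom.comp (AlgHom.snd ℂ A A))
  let p : ofSubalgebra S ⟶ A := ofHom
    ⟨(AlgHom.fst ℂ A A).comp S.val, continuous_fst.comp continuous_subtype_val⟩
  let q : ofSubalgebra S ⟶ A := ofHom
    ⟨(AlgHom.snd ℂ A A).comp S.val, continuous_snd.comp continuous_subtype_val⟩
  have hpq : p ≫ f = q ≫ f := by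
    apply ConcreteCategory.hom_ext
    intro x
    exact x.2
  intro x y hxy
  exact congrArg (fun g : ofSubalgebra S ⟶ A => ConcreteCategory.hom g ⟨(x, y), hxy⟩)
    ((cancel_mono f).1 hpq)

theorem mono_of_injective {A B : TopAlg.{u}} (f : A ⟶ B)
    (hf : Function.Injective (ConcreteCategory.hom f)) : Mono f :=
  ⟨fun g h w => by
    apply ConcreteCategory.hom_ext
    intro x
    exact hf (hom_apply_congr w x)⟩

theorem epi_of_denseRange {A B : TopAlg.{u}} (f : A ⟶ B)
    (hf : DenseRange (ConcreteCategory.hom f)) : Epi f :=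
  ⟨fun {Z} g h w => by
    apply ConcreteCategory.hom_ext
    intro x
    exact congrFun (hf.equalizer (continuous_hom g) (continuous_hom h)
      (funext fun y => hom_apply_congr w y)) x⟩

/-- An algebra with a Hausdorff topology that is an open quotient of a topological algebra is a
topological algebra. -/
def ofIsOpenQuotientMap {A : TopAlg.{u}} {R : Type u} [Ring R] [Algebra ℂ R] [TopologicalSpace R]
    [T2Space R] (π : A →ₐ[ℂ] R) (hπ : IsOpenQuotientMap π) : TopAlg.{u} :=
  { carrier := R
    isTopologicalAddGroup :=
      { continuous_add := by
          rw [← (hπ.prodMap hπ).continuous_comp_iff]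
          have : Continuous fun p : A × A => π (p.1 + p.2) := hπ.continuous.comp continuous_add
          exact this.congr fun p => map_add π _ _
        continuous_neg := by
          rw [← hπ.continuous_comp_iff]
          have : Continuous fun p : A => π (-p) := hπ.continuous.comp continuous_neg
          exact this.congr fun p => map_neg π _ }
    continuousSMul :=
      { continuous_smul := by
          rw [← (IsOpenQuotientMap.id.prodMap hπ).continuous_comp_iff]
          have : Continuous fun p : ℂ × A => π (p.1 • p.2) := hπ.continuous.comp continuous_smul
          exact this.congr fun p => map_smul π _ _ }
    locallyConvex := by
      have hb := (LocallyConvexSpace.convex_basis (𝕜 := ℝ) (E := A))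
      -- The convex neighbourhoods of a chosen preimage of `y` have images that form a basis at `y`,
      -- since an open continuous map carries the neighbourhood filter of a point onto that of its
      -- image.
      refine LocallyConvexSpace.ofBases ℝ R
        (fun y s => π '' s)
        (fun y s => s ∈ nhds ((hπ.surjective y).choose) ∧ Convex ℝ s) (fun y => ?_) ?_
      · have h := (hb (hπ.surjective y).choose).map π
        rwa [hπ.isOpenMap.map_nhds_eq hπ.continuous.continuousAt,
          (hπ.surjective y).choose_spec] at h
      · rintro y s ⟨-, hs⟩
        exact hs.linear_image (π.toLinearMap.restrictScalars ℝ)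
    separatelyContinuousMul :=
      { continuous_const_mul := by
          intro a
          obtain ⟨a, rfl⟩ := hπ.surjective a
          rw [← hπ.continuous_comp_iff]
          have : Continuous fun p : A => π (a * p) := hπ.continuous.comp (continuous_const_mul a)
          exact this.congr fun p => map_mul π _ _
        continuous_mul_const := by
          intro a
          obtain ⟨a, rfl⟩ := hπ.surjective a
          rw [← hπ.continuous_comp_iff]
          have : Continuous fun p : A => π (p * a) := hπ.continuous.comp (continuous_mul_const a)
          exact this.congr fun p => map_mul π _ _ } }

/-! ### Nodal decompositions -/

/-- A surjective open morphism is a strong epimorphism. -/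
theorem strongEpi_of_isOpenQuotientMap {A B : TopAlg.{u}} (p : A ⟶ B)
    (hp : IsOpenQuotientMap (ConcreteCategory.hom p)) : StrongEpi p := by
  have : Epi p := epi_of_denseRange p hp.surjective.denseRange
  refine StrongEpi.mk' fun X Y z hz s t sq => ?_
  have hinj := ofHom_injective_of_mono z
  have hw : ∀ a, ConcreteCategory.hom z (ConcreteCategory.hom s a) =
      ConcreteCategory.hom t (ConcreteCategory.hom p a) := hom_apply_congr sq.w
  have hex : ∀ b, ∃ x, ConcreteCategory.hom z x = ConcreteCategory.hom t b := fun b => by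
    obtain ⟨a, rfl⟩ := hp.surjective b
    exact ⟨_, hw a⟩
  -- The diagonal is chosen pointwise. Injectivity of `z` makes it a homomorphism, and the quotient
  -- topology makes it continuous.
  choose l hl using hex
  have hls : ∀ a, l (ConcreteCategory.hom p a) = ConcreteCategory.hom s a := fun a =>
    hinj ((hl _).trans (hw a).symm)
  let L : B →A[ℂ] X :=
    { toFun := l
      map_one' := hinj (by rw [hl, map_one, map_one])
      map_mul' := fun x y => hinj (by rw [hl, map_mul, map_mul, hl, hl])
      map_zero' := hinj (by rw [hl, map_zero, map_zero])
      map_add' := fun x y => hinj (by rw [hl, map_add, map_add, hl, hl])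
      commutes' := fun r => hinj (by
        rw [hl]; exact (AlgHomClass.commutes _ r).trans (AlgHomClass.commutes _ r).symm)
      cont := by
        rw [← hp.continuous_comp_iff]
        exact (continuous_hom s).congr fun a => (hls a).symm }
  exact ⟨⟨{ l := ofHom L
            fac_left := ConcreteCategory.hom_ext _ _ hls
            fac_right := ConcreteCategory.hom_ext _ _ hl }⟩⟩

/-- Every morphism is a strong epimorphism followed by a monomorphism. -/
theorem exists_strongEpi_mono_fac {A B : TopAlg.{u}} (f : A ⟶ B) :
    ∃ (Q : TopAlg.{u}) (p : A ⟶ Q) (m : Q ⟶ B), StrongEpi p ∧ Mono m ∧ p ≫ m = f := by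
  let φ : A →A[ℂ] B := ConcreteCategory.hom f
  let I : Ideal A := RingHom.ker φ
  let : TopologicalSpace (A ⧸ I) := QuotientModule.Quotient.topologicalSpace (S := I)
  have hπ : IsOpenQuotientMap (Ideal.Quotient.mkₐ ℂ I) := Submodule.isOpenQuotientMap_mkQ I
  let g : (A ⧸ I) →ₐ[ℂ] B := Ideal.Quotient.liftₐ I φ.toAlgHom fun a ha => ha
  have hg : Function.Injective g := RingHom.kerLift_injective φ.toRingHom
  have hgc : Continuous g := by
    rw [← hπ.continuous_comp_iff]
    exact φ.cont
  -- The quotient is Hausdorff because it injects continuously into `B`.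
  have : T2Space (A ⧸ I) := T2Space.of_injective_continuous hg hgc
  let p : A ⟶ ofIsOpenQuotientMap _ hπ := ofHom ⟨Ideal.Quotient.mkₐ ℂ I, hπ.continuous⟩
  let m : ofIsOpenQuotientMap _ hπ ⟶ B := ofHom ⟨g, hgc⟩
  exact ⟨_, p, m, strongEpi_of_isOpenQuotientMap p hπ, mono_of_injective m hg, rfl⟩

/-- A subalgebra of `B` is absolutely closed in `B` if every morphism into `B` that maps the
image of some epimorphism into it has its image in it. -/
def IsAbsolutelyClosed {B : TopAlg.{u}} (S : Subalgebra ℂ B) : Prop :=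
  ∀ ⦃P Q : TopAlg.{u}⦄ (p : P ⟶ Q) [Epi p] (v : Q ⟶ B),
    (∀ x, ConcreteCategory.hom v (ConcreteCategory.hom p x) ∈ S) →
      ∀ y, ConcreteCategory.hom v y ∈ S

/-- The inclusion of a subalgebra. -/
def inclusion {B : TopAlg.{u}} (S : Subalgebra ℂ B) : ofSubalgebra S ⟶ B :=
  ofHom ⟨S.val, continuous_subtype_val⟩

/-- The corestriction of a morphism to a subalgebra. -/
def corestrict {A B : TopAlg.{u}} (f : A ⟶ B) (S : Subalgebra ℂ B)
    (h : ∀ x, ConcreteCategory.hom f x ∈ S) : A ⟶ ofSubalgebra S :=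
  ofHom ⟨(ConcreteCategory.hom f : A →A[ℂ] B).toAlgHom.codRestrict S h,
    Continuous.subtype_mk (ConcreteCategory.hom f : A →A[ℂ] B).cont _⟩

theorem corestrict_inclusion {A B : TopAlg.{u}} (f : A ⟶ B) (S : Subalgebra ℂ B)
    (h : ∀ x, ConcreteCategory.hom f x ∈ S) : corestrict f S h ≫ inclusion S = f := rfl

instance {B : TopAlg.{u}} (S : Subalgebra ℂ B) : Mono (inclusion S) :=
  mono_of_injective _ Subtype.val_injective

/-- Absolute closedness says exactly that the bottom of a lifting square corestricts to `S`; this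
corestriction is the diagonal. -/
theorem IsAbsolutelyClosed.strongMono_inclusion {B : TopAlg.{u}} {S : Subalgebra ℂ B}
    (hS : IsAbsolutelyClosed S) : StrongMono (inclusion S) := by
  refine StrongMono.mk' fun P Q p _ s t sq => ?_
  have hw : ∀ x, ConcreteCategory.hom t (ConcreteCategory.hom p x) ∈ S := fun x => by
    have : _ = ConcreteCategory.hom t (ConcreteCategory.hom p x) := hom_apply_congr sq.w x
    exact this ▸ (ConcreteCategory.hom s x).2
  refine ⟨⟨{ l := corestrict t S (hS p t hw)
             fac_left := ?_
             fac_right := rfl }⟩⟩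
  rw [← cancel_mono (inclusion S), Category.assoc, corestrict_inclusion, sq.w]

/-- Every morphism is an epimorphism followed by a strong monomorphism. -/
theorem exists_epi_strongMono_fac {A B : TopAlg.{u}} (f : A ⟶ B) :
    ∃ (I : TopAlg.{u}) (e : A ⟶ I) (i : I ⟶ B), Epi e ∧ StrongMono i ∧ e ≫ i = f := by
  let T : Subalgebra ℂ B := sInf {S | IsAbsolutelyClosed S ∧ ∀ x, ConcreteCategory.hom f x ∈ S}
  have hT : IsAbsolutelyClosed T := fun P Q p _ t h y =>
    Algebra.mem_sInf.2 fun S hS => hS.1 p t (fun x => Algebra.mem_sInf.1 (h x) S hS) y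
  have hfT : ∀ x, ConcreteCategory.hom f x ∈ T := fun x => Algebra.mem_sInf.2 fun S hS => hS.2 x
  refine ⟨_, corestrict f T hfT, inclusion T, ⟨fun {Z} g h w => ?_⟩, hT.strongMono_inclusion, rfl⟩
  -- To show that `g = h`, view their equalizer as a subalgebra of `B`. It is absolutely closed and
  -- contains the image of `f`, so by minimality of `T` it is all of `T`.
  let E : Subalgebra ℂ B := (AlgHom.equalizer
    (ConcreteCategory.hom g : ofSubalgebra T →A[ℂ] Z).toAlgHom
    (ConcreteCategory.hom h : ofSubalgebra T →A[ℂ] Z).toAlgHom).map T.val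
  have hE : IsAbsolutelyClosed E := by
    intro P Q p _ t ht y
    have htT : ∀ y, ConcreteCategory.hom t y ∈ T := hT p t fun x => by
      obtain ⟨z, -, hz⟩ := ht x
      exact hz ▸ z.2
    have hk : corestrict t T htT ≫ g = corestrict t T htT ≫ h := by
      rw [← cancel_epi p]
      apply ConcreteCategory.hom_ext
      intro x
      obtain ⟨z, hz, hzx⟩ := ht x
      have : z = ConcreteCategory.hom (corestrict t T htT) (ConcreteCategory.hom p x) :=
        Subtype.ext hzx
      rw [this] at hz
      exact hz
    exact ⟨ConcreteCategory.hom (corestrict t T htT) y,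
      hom_apply_congr hk y, rfl⟩
  have hfE : ∀ x, ConcreteCategory.hom f x ∈ E := fun x =>
    ⟨⟨_, hfT x⟩, hom_apply_congr w x, rfl⟩
  apply ConcreteCategory.hom_ext
  intro x
  obtain ⟨z, hz, hzx⟩ := Algebra.mem_sInf.1 x.2 E ⟨hE, hfE⟩
  have : z = x := Subtype.ext hzx
  rw [this] at hz
  exact hz

/-- Every morphism of topological algebras has a nodal decomposition. -/
theorem nonempty_nodalDecomposition {A B : TopAlg.{u}} (f : A ⟶ B) :
    Nonempty (NodalDecomposition f) := by
  obtain ⟨Q, p, m, hp, hm, rfl⟩ := exists_strongEpi_mono_fac f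
  obtain ⟨I, e, i, he, hi, rfl⟩ := exists_epi_strongMono_fac m
  exact ⟨⟨Q, I, p, e, i, hp, mono_of_mono e i, he, hi, rfl⟩⟩

/-! ### Factorization through Banach quotient algebras -/

namespace SubmultNhd

variable {A : TopAlg.{u}}

theorem denseRange_quotientMap (U : SubmultNhd A) :
    DenseRange (ConcreteCategory.hom U.quotientMap) :=
  UniformSpace.Completion.denseRange_coe (α := U.Seminormed)

/-- A morphism into a Banach algebra that is bounded by the seminorm of `U` factors through the
Banach quotient map of `U`. -/
theorem exists_fac (U : SubmultNhd A) (R : Type u) [NormedRing R] [NormedAlgebra ℂ R]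
    [CompleteSpace R] (φ : A ⟶ ofBanach R)
    (h : ∀ x, ‖(show R from ConcreteCategory.hom φ x)‖ ≤ U.seminorm x) :
    ∃ ψ : U.quotient ⟶ ofBanach R, U.quotientMap ≫ ψ = φ := by
  let f : U.Seminormed →+* R := ((ConcreteCategory.hom φ : A →A[ℂ] ofBanach R) : A →+* ofBanach R)
  have hf : Continuous f :=
    AddMonoidHomClass.continuous_of_bound f 1 fun x => (h x).trans_eq (one_mul _).symm
  let g : U.Completed →+* R := UniformSpace.Completion.extensionHom f hf
  have hg : ∀ x : A, g (ConcreteCategory.hom U.quotientMap x) = ConcreteCategory.hom φ x :=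
    fun x => UniformSpace.Completion.extensionHom_coe f hf x
  let G : U.quotient →A[ℂ] ofBanach R :=
    { g with
      commutes' := fun r => (hg (algebraMap ℂ A r)).trans (AlgHomClass.commutes _ r)
      cont := UniformSpace.Completion.continuous_extension (β := R) (f := f) }
  exact ⟨ofHom G, ConcreteCategory.hom_ext _ _ hg⟩

theorem norm_quotientMap (U : SubmultNhd A) (x : A) :
    ‖(show U.Completed from ConcreteCategory.hom U.quotientMap x)‖ = U.seminorm x :=
  UniformSpace.Completion.norm_coe (E := U.Seminormed) x

/-- A smaller neighbourhood has a larger gauge, so `U.quotientMap` is bounded by the seminorm of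
`V`. -/
theorem exists_quotient_hom {U V : SubmultNhd A} (h : V.carrier ⊆ U.carrier) :
    ∃ ψ : V.quotient ⟶ U.quotient, V.quotientMap ≫ ψ = U.quotientMap :=
  V.exists_fac U.Completed U.quotientMap fun x =>
    (U.norm_quotientMap x).trans_le (gauge_mono V.absorbent h x)

/-- The whole algebra. -/
def top (A : TopAlg.{u}) : SubmultNhd A where
  carrier := Set.univ
  mem_nhds := Filter.univ_mem
  isClosed := isClosed_univ
  balanced := fun _ _ => Set.subset_univ _
  convex := convex_univ
  mul_mem _ _ _ _ := Set.mem_univ _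

/-- The intersection of two submultiplicative neighbourhoods of zero. -/
def inter (U V : SubmultNhd A) : SubmultNhd A where
  carrier := U.carrier ∩ V.carrier
  mem_nhds := Filter.inter_mem U.mem_nhds V.mem_nhds
  isClosed := U.isClosed.inter V.isClosed
  balanced := U.balanced.inter V.balanced
  convex := U.convex.inter V.convex
  mul_mem _ _ hx hy := ⟨U.mul_mem hx.1 hy.1, V.mul_mem hx.2 hy.2⟩

/-- Directedness of the index system, which reduces finitely many coordinates of the limit to one.
-/
theorem exists_subset_of_finset (s : Finset (SubmultNhd A)) :
    ∃ V : SubmultNhd A, ∀ U ∈ s, V.carrier ⊆ U.carrier := by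
  classical
  induction s using Finset.induction_on with
  | empty => exact ⟨top A, by simp⟩
  | insert U s _ ih =>
    obtain ⟨V, hV⟩ := ih
    refine ⟨U.inter V, fun W hW => ?_⟩
    rcases Finset.mem_insert.1 hW with rfl | hW
    · exact Set.inter_subset_left
    · exact Set.inter_subset_right.trans (hV W hW)

/-- The preimage of the unit ball of a Banach algebra. -/
def preimageUnitBall (R : Type u) [NormedRing R] [NormedAlgebra ℂ R] [CompleteSpace R]
    (φ : A →A[ℂ] R) : SubmultNhd A where
  carrier := {x | ‖φ x‖ ≤ 1}
  mem_nhds := by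
    have h : Continuous fun x => ‖φ x‖ := φ.cont.norm
    have h0 : ‖φ 0‖ < 1 := by simp
    exact (h.tendsto 0).eventually_le_const h0
  isClosed := isClosed_le φ.cont.norm continuous_const
  balanced := by
    rintro c hc _ ⟨x, hx, rfl⟩
    change ‖φ (c • x)‖ ≤ 1
    rw [map_smul, norm_smul]
    exact mul_le_one₀ hc (norm_nonneg _) hx
  convex := by
    intro x hx y hy a b ha hb hab
    have h : φ (a • x + b • y) = a • φ x + b • φ y :=
      (map_add φ _ _).trans (congrArg₂ (· + ·)
        (map_smul (φ.toAlgHom.toLinearMap.restrictScalars ℝ) a x)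
        (map_smul (φ.toAlgHom.toLinearMap.restrictScalars ℝ) b y))
    change ‖φ (a • x + b • y)‖ ≤ 1
    rw [h]
    calc ‖a • φ x + b • φ y‖ ≤ a * ‖φ x‖ + b * ‖φ y‖ := by
          refine (norm_add_le _ _).trans_eq ?_
          rw [norm_smul, norm_smul, Real.norm_of_nonneg ha, Real.norm_of_nonneg hb]
      _ ≤ a * 1 + b * 1 := by gcongr <;> assumption
      _ = 1 := by rw [mul_one, mul_one, hab]
  mul_mem x y hx hy := by
    change ‖φ (x * y)‖ ≤ 1
    rw [map_mul]
    exact (norm_mul_le _ _).trans (mul_le_one₀ hx (norm_nonneg _) hy)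

theorem norm_le_seminorm_preimageUnitBall (R : Type u) [NormedRing R] [NormedAlgebra ℂ R]
    [CompleteSpace R] (φ : A →A[ℂ] R) (x : A) :
    ‖φ x‖ ≤ (preimageUnitBall R φ).seminorm x := by
  refine le_of_forall_gt_imp_ge_of_dense fun r hr => ?_
  -- Any `r` above the gauge of `x` allows `x = c • y` with `c < r` and `‖φ y‖ ≤ 1`.
  obtain ⟨c, hc, hcr, y, hy, rfl⟩ := exists_lt_of_gauge_lt (preimageUnitBall R φ).absorbent hr
  have : φ (c • y) = c • φ y := map_smul (φ.toAlgHom.toLinearMap.restrictScalars ℝ) c y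
  simp only [this, norm_smul, Real.norm_of_nonneg hc.le]
  exact (mul_le_of_le_one_right hc.le hy).trans hcr.le

end SubmultNhd

/-- Every morphism into a Banach algebra factors through a Banach quotient map. -/
theorem IsBanach.exists_fac_quotientMap {A B : TopAlg.{u}} (hB : B.IsBanach) (φ : A ⟶ B) :
    ∃ (U : SubmultNhd A) (ψ : U.quotient ⟶ B), U.quotientMap ≫ ψ = φ := by
  obtain ⟨R, _, _, _, ⟨i⟩⟩ := hB
  let U := SubmultNhd.preimageUnitBall R (ConcreteCategory.hom (φ ≫ i.hom))
  obtain ⟨ψ, hψ⟩ := U.exists_fac R (φ ≫ i.hom)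
    (SubmultNhd.norm_le_seminorm_preimageUnitBall R (ConcreteCategory.hom (φ ≫ i.hom)))
  exact ⟨U, ψ ≫ i.inv, by rw [← Category.assoc, hψ, Category.assoc, i.hom_inv_id,
    Category.comp_id]⟩

/-! ### The Arens–Michael envelope -/

variable (A : TopAlg.{u})

theorem denseRange_heart : DenseRange (ConcreteCategory.hom A.heart) := by
  -- Density is proved in the concrete limit, whose topology is induced from the product, and then
  -- transported along the canonical isomorphism.
  let l := (limitConeIsLimit (quotientDiagram A)).lift (quotientCone A)
  let i := (limitConeIsLimit (quotientDiagram A)).conePointUniqueUpToIso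
    (limit.isLimit (quotientDiagram A))
  have hl : l ≫ i.hom = A.heart := IsLimit.lift_comp_conePointUniqueUpToIso_hom _ _
  have hi : Function.Surjective (ConcreteCategory.hom i.hom) := fun y =>
    ⟨ConcreteCategory.hom i.inv y,
      hom_apply_congr i.inv_hom_id y⟩
  have hld : DenseRange (ConcreteCategory.hom l) := by
    rw [DenseRange, dense_iff_inter_open]
    rintro _ ⟨s, hs, rfl⟩ ⟨x, hx⟩
    obtain ⟨I, t, ht, hts⟩ := isOpen_pi_iff.1 hs x.1 hx
    obtain ⟨V, hV⟩ := SubmultNhd.exists_subset_of_finset (A := A) I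
    choose ψ hψ using fun U : I =>
      SubmultNhd.exists_quotient_hom (hV U.1 U.2)
    have hx' : ∀ U : I, ConcreteCategory.hom (ψ U) (x.1 V) ∈ t U := fun U => by
      let f : @Quiver.Hom (QuotientIndex A) _ V U.1 := InducedCategory.homMk (Under.homMk (ψ U) (hψ U))
      have : ConcreteCategory.hom (ψ U) (x.1 V) = x.1 U := x.2 f
      exact this ▸ (ht U U.2).2
    -- The finitely many conditions pull back to one open subset of `A / V`, nonempty since it
    -- contains the coordinate `x.1 V`; the dense image of `ρ_V` meets it.
    obtain ⟨_, hy, a, rfl⟩ := V.denseRange_quotientMap.inter_open_nonempty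
      (⋂ U : I, ConcreteCategory.hom (ψ U) ⁻¹' t U)
      (isOpen_iInter_of_finite fun U => (ht U U.2).1.preimage (continuous_hom (ψ U)))
      ⟨x.1 V, Set.mem_iInter.2 hx'⟩
    refine ⟨ConcreteCategory.hom l a, hts fun U hU => ?_, a, rfl⟩
    have h := Set.mem_iInter.1 hy ⟨U, hU⟩
    have hU' : ConcreteCategory.hom (ψ ⟨U, hU⟩) (ConcreteCategory.hom V.quotientMap a) =
        (ConcreteCategory.hom l a).1 U := hom_apply_congr (hψ ⟨U, hU⟩) a
    exact hU' ▸ h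
  rw [← hl]
  exact hi.denseRange.comp hld (continuous_hom i.hom)

variable {A} in
/-- The projection of the range of the Arens–Michael envelope to a Banach quotient algebra. -/
noncomputable def arensMichaelProj (U : SubmultNhd A) : arensMichael A ⟶ U.quotient :=
  limit.π (quotientDiagram A) U

variable {A} in
theorem heart_proj (U : SubmultNhd A) : A.heart ≫ arensMichaelProj U = U.quotientMap :=
  limit.lift_π (quotientCone A) U

theorem exists_heart_fac {B : TopAlg.{u}} (hB : B.IsBanach) (φ : A ⟶ B) :
    ∃ ψ : arensMichael A ⟶ B, A.heart ≫ ψ = φ := by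
  obtain ⟨U, ψ, rfl⟩ := hB.exists_fac_quotientMap φ
  exact ⟨arensMichaelProj U ≫ ψ, by rw [← Category.assoc, heart_proj]⟩

theorem SubmultNhd.isBanach_quotient {A : TopAlg.{u}} (U : SubmultNhd A) : U.quotient.IsBanach :=
  ⟨U.Completed, inferInstance, inferInstance, inferInstance, ⟨Iso.refl _⟩⟩

variable {A} {Ω : MorphismProperty TopAlg.{u}}

theorem denseEpiClass_le_epimorphisms :
    denseEpiClass ≤ MorphismProperty.epimorphisms TopAlg.{u} :=
  fun _ _ f hf => epi_of_denseRange f hf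

theorem isExtension_heart (h : Ω A.heart) : IsExtension Ω toBanach A.heart := by
  have : Epi A.heart := epi_of_denseRange _ A.denseRange_heart
  refine ⟨h, fun B φ hφ => ?_⟩
  obtain ⟨ψ, hψ⟩ := A.exists_heart_fac hφ φ
  exact ⟨ψ, hψ, fun χ hχ => by rw [← cancel_epi A.heart, hψ, hχ]⟩

/-- Morphisms extend along extensions to morphisms into Arens–Michael envelopes. -/
theorem exists_extend_heart (hΩ : Ω ≤ MorphismProperty.epimorphisms TopAlg.{u})
    {X E Y : TopAlg.{u}} (e : X ⟶ E) (he : IsExtension Ω toBanach e) (α : X ⟶ Y) :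
    ∃ γ : E ⟶ arensMichael Y, e ≫ γ = α ≫ Y.heart := by
  have : Epi e := hΩ _ he.1
  choose t ht _ using fun U : SubmultNhd Y => he.2 (α ≫ U.quotientMap) U.isBanach_quotient
  -- Both sides agree after precomposition with the epimorphism `e`, so the `t U` form a cone.
  have hnat : ∀ (U V : SubmultNhd Y) (f : U.quotient ⟶ V.quotient),
      U.quotientMap ≫ f = V.quotientMap → t U ≫ f = t V := fun U V f hf => by
    rw [← cancel_epi e, ht V, ← hf, ← Category.assoc, ht U, Category.assoc]
  let c : Cone (quotientDiagram Y) :=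
    { pt := E
      π :=
        { app := t
          naturality := fun U V f =>
            (Category.id_comp _).trans (hnat U V _ (Under.w f.hom)).symm } }
  let γ : E ⟶ arensMichael Y := limit.lift (quotientDiagram Y) c
  have hγ : ∀ U : SubmultNhd Y, γ ≫ arensMichaelProj U = t U := fun U => limit.lift_π c U
  have key : ∀ U : SubmultNhd Y,
      (e ≫ γ) ≫ arensMichaelProj U = (α ≫ Y.heart) ≫ arensMichaelProj U := fun U => by
    rw [Category.assoc, hγ, ht, Category.assoc, heart_proj]
  exact ⟨γ, limit.hom_ext key⟩

theorem isEnvelope_heart (hΩ : Ω ≤ MorphismProperty.epimorphisms TopAlg.{u}) (h : Ω A.heart) :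
    IsEnvelope Ω toBanach A.heart :=
  (isExtension_heart h).isEnvelope hΩ fun _ e he => by
    simpa using exists_extend_heart hΩ e he (𝟙 A)

theorem envelopeIsFunctor_of_heart (hΩ : Ω ≤ MorphismProperty.epimorphisms TopAlg.{u})
    (h : ∀ A : TopAlg.{u}, Ω A.heart) : EnvelopeIsFunctor Ω toBanach :=
  envelopeIsFunctor_of_exists_extend hΩ fun Y =>
    ⟨_, Y.heart, isExtension_heart (h Y), fun _ _ e he α => exists_extend_heart hΩ e he α⟩

/-! ### The nodal coimage of the Arens–Michael envelope -/

theorem strongEpiClass_le_epimorphisms :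
    strongEpiClass TopAlg.{u} ≤ MorphismProperty.epimorphisms TopAlg.{u} :=
  fun _ _ _ hf => StrongEpi.epi (self := hf)

/-- Morphisms to Banach algebras already factor through `heart`, hence through its first factor
`D.coim`. -/
theorem isExtension_coim (D : NodalDecomposition A.heart) :
    IsExtension (strongEpiClass TopAlg.{u}) toBanach D.coim := by
  have := D.strongEpi_coim
  refine ⟨D.strongEpi_coim, fun B φ hφ => ?_⟩
  obtain ⟨ψ, hψ⟩ := A.exists_heart_fac hφ φ
  have h : D.coim ≫ (D.red ≫ D.im) ≫ ψ = φ := by rw [← Category.assoc, D.fac, hψ]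
  exact ⟨_, h, fun χ hχ => by rw [← cancel_epi D.coim, hχ, h]⟩

theorem exists_extend_coim {X E Y : TopAlg.{u}} (D : NodalDecomposition Y.heart) (e : X ⟶ E)
    (he : IsExtension (strongEpiClass TopAlg.{u}) toBanach e) (α : X ⟶ Y) :
    ∃ γ : E ⟶ D.Coim, e ≫ γ = α ≫ D.coim := by
  have : StrongEpi e := he.1
  have := D.mono_red
  have := D.strongMono_im
  obtain ⟨β, hβ⟩ := exists_extend_heart strongEpiClass_le_epimorphisms e he α
  -- `D.red ≫ D.im` is a monomorphism, so the strong epimorphism `e` has the lifting property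
  -- against it.
  have sq : CommSq (α ≫ D.coim) e (D.red ≫ D.im) β := ⟨by rw [hβ, Category.assoc, D.fac]⟩
  exact ⟨sq.lift, sq.fac_left⟩

theorem isEnvelope_coim (D : NodalDecomposition A.heart) :
    IsEnvelope (strongEpiClass TopAlg.{u}) toBanach D.coim :=
  (isExtension_coim D).isEnvelope strongEpiClass_le_epimorphisms fun _ e he => by
    simpa using exists_extend_coim D e he (𝟙 A)

end TopAlg

theorem mainTheorem11 :
    (HasEnvelopes (MorphismProperty.epimorphisms TopAlg.{u}) TopAlg.toBanach ∧
      HasEnvelopes TopAlg.denseEpiClass.{u} TopAlg.toBanach ∧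
      HasEnvelopes (strongEpiClass TopAlg.{u}) TopAlg.toBanach) ∧
    (∀ A : TopAlg.{u},
      IsEnvelope (MorphismProperty.epimorphisms TopAlg.{u}) TopAlg.toBanach A.heart ∧
      IsEnvelope TopAlg.denseEpiClass TopAlg.toBanach A.heart) ∧
    (∀ A : TopAlg.{u},
      Nonempty (NodalDecomposition A.heart) ∧
      ∀ D : NodalDecomposition A.heart,
        IsEnvelope (strongEpiClass TopAlg.{u}) TopAlg.toBanach D.coim) ∧
    (EnvelopeIsFunctor (MorphismProperty.epimorphisms TopAlg.{u}) TopAlg.toBanach ∧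
      EnvelopeIsFunctor TopAlg.denseEpiClass.{u} TopAlg.toBanach ∧
      EnvelopeIsFunctor (strongEpiClass TopAlg.{u}) TopAlg.toBanach) := by
  have hepi : ∀ A : TopAlg.{u}, MorphismProperty.epimorphisms TopAlg.{u} A.heart := fun A =>
    TopAlg.epi_of_denseRange _ A.denseRange_heart
  have hdense : ∀ A : TopAlg.{u}, TopAlg.denseEpiClass A.heart := fun A => A.denseRange_heart
  have hheart : ∀ A : TopAlg.{u},
      IsEnvelope (MorphismProperty.epimorphisms TopAlg.{u}) TopAlg.toBanach A.heart ∧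
      IsEnvelope TopAlg.denseEpiClass TopAlg.toBanach A.heart := fun A =>
    ⟨TopAlg.isEnvelope_heart le_rfl (hepi A),
      TopAlg.isEnvelope_heart TopAlg.denseEpiClass_le_epimorphisms (hdense A)⟩
  refine ⟨⟨fun A => ⟨_, _, (hheart A).1⟩, fun A => ⟨_, _, (hheart A).2⟩, fun A => ?_⟩, hheart,
    fun A => ⟨TopAlg.nonempty_nodalDecomposition _, TopAlg.isEnvelope_coim⟩,
    TopAlg.envelopeIsFunctor_of_heart le_rfl hepi,
    TopAlg.envelopeIsFunctor_of_heart TopAlg.denseEpiClass_le_epimorphisms hdense,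
    envelopeIsFunctor_of_exists_extend TopAlg.strongEpiClass_le_epimorphisms fun Y => ?_⟩
  · obtain ⟨D⟩ := TopAlg.nonempty_nodalDecomposition A.heart
    exact ⟨_, _, TopAlg.isEnvelope_coim D⟩
  · obtain ⟨D⟩ := TopAlg.nonempty_nodalDecomposition Y.heart
    exact ⟨_, _, TopAlg.isExtension_coim D, fun _ _ e he α => TopAlg.exists_extend_coim D e he α⟩
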